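/- Let $K$ be an algebraically closed field of characteristic zero, and let $R=K[s,t,u,v]$ be the total coordinate ring of $\mathbb{P}^1\times\mathbb{P}^1$, bigraded by $\deg s=\deg t=(1,0)$ and $\deg u=\deg v=(0,1)$. For a finite set $X\subset\mathbb{P}^1\times\mathbb{P}^1$ let $I_X=\bigcap_{P\in X}I_P\subseteq R$ be its ideal, where $I_{A\times B}=\langle h,l\rangle$ with $h\in R_{(1,0)}$ and $l\in R_{(0,1)}$ nonzero forms vanishing at $A$ and $B$ respectively. Suppose that $X$ consists of $r=2k$ points ($k\ge 0$) and is generic, i.e. $\dim_K R_{(i,j)}-\dim_K (I_X)_{(i,j)}=\min\{(i+1)(j+1),r\}$ for all $i,j\ge 0$. For linearly independent forms $f_0,\dots,f_3$ of one bidegree with span $U$, let $X_U\subset\mathbb{P}^3$ denote the Zariski closure of the image of the rational map $\lambda_U=(f_0:f_1:f_2:f_3):\mathbb{P}^1\times\mathbb{P}^1\dashrightarrow\mathbb{P}^3$, and let $X,Y,Z,W$ also denote the coordinates on $\mathbb{P}^3$. Then: 1. $\dim_K (I_X)_{(k,1)}=2$, and any basis $g_1,g_2$ of $(I_X)_{(k,1)}$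 generates the $K[s,t]$-module $\bigoplus_{i\ge 0}(I_X)_{(i,1)}$. 2. For any such $g_1,g_2$, the forms $sg_1,tg_1,sg_2,tg_2$ are a $K$-basis of $(I_X)_{(k+1,1)}$; in particular $\dim_K (I_X)_{(k+1,1)}=4$. 3. For the basis $(sg_1,tg_1,sg_2,tg_2)$, the closure of the image is $\mathbb{V}(XW-YZ)$, which is a smooth quadric. 4. If $U$ is any $4$-dimensional subspace of $(I_X)_{(k+1,1)}$, then $U=(I_X)_{(k+1,1)}$. For every basis $f_0,\dots,f_3$ of $U$ the surface $X_U$ is smooth; moreover there is a linear automorphism $e$ of $K^4$ with $(f_0,f_1,f_2,f_3)^T=e\,(sg_1,tg_1,sg_2,tg_2)^T$, and $X_U$ is the image of $\mathbb{V}(XW-YZ)$ under the projective transformation of $\mathbb{P}^3$ induced by $e$. -/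

import Mathlib

open MvPolynomial

namespace TensorSurface

/-- The total coordinate ring `K[s,t] ⊗ K[u,v] = K[s,t,u,v]` of `ℙ¹ × ℙ¹`. The variables
`Sum.inl 0, Sum.inl 1` are `s, t`, and `Sum.inr 0, Sum.inr 1` are `u, v`. -/
abbrev Cox (K : Type*) [Field K] : Type _ := MvPolynomial (Fin 2 ⊕ Fin 2) K

/-- Points of `ℙ¹ × ℙ¹`. -/
abbrev Pt (K : Type*) [Field K] : Type _ :=
  Projectivization K (Fin 2 → K) × Projectivization K (Fin 2 → K)

/-- Projective 3-space over `K`. -/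
abbrev P3 (K : Type*) [Field K] : Type _ := Projectivization K (Fin 4 → K)

variable {K : Type*} [Field K]

/-- The variable `s`. -/
noncomputable def varS : Cox K := X (Sum.inl 0)

/-- The variable `t`. -/
noncomputable def varT : Cox K := X (Sum.inl 1)

/-- The bidegrees of the variables: `deg s = deg t = (1,0)` and `deg u = deg v = (0,1)`. -/
def bideg : Fin 2 ⊕ Fin 2 → ℕ × ℕ := Sum.elim (fun _ => (1, 0)) (fun _ => (0, 1))

variable (K) in
/-- `R_(a,b)`, the space of forms of bidegree `(a,b)`. -/
noncomputable def forms (a b : ℕ) : Submodule K (Cox K) :=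
  weightedHomogeneousSubmodule K bideg (a, b)

/-- The ideal of the point `A × B`: it is generated by the linear form in `s, t` that vanishes
at `A` and the linear form in `u, v` that vanishes at `B` (each unique up to a unit). -/
noncomputable def pointIdeal (P : Pt K) : Ideal (Cox K) :=
  Ideal.span
    {C (P.1.rep 1) * X (Sum.inl 0) - C (P.1.rep 0) * X (Sum.inl 1),
     C (P.2.rep 1) * X (Sum.inr 0) - C (P.2.rep 0) * X (Sum.inr 1)}

/-- The ideal `I_X` of a finite set of points (the whole ring if the set is empty). -/
noncomputable def pointsIdeal (X : Finset (Pt K)) : Ideal (Cox K) :=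
  ⨅ P ∈ X, pointIdeal P

/-- The graded piece `(I_X)_(a,b)`. -/
noncomputable def piece (X : Finset (Pt K)) (a b : ℕ) : Submodule K (Cox K) :=
  (pointsIdeal X).restrictScalars K ⊓ forms K a b

/-- The bigraded Hilbert function `H_X(i,j) = dim R_(i,j) - dim (I_X)_(i,j)`. -/
noncomputable def hilbertFunction (X : Finset (Pt K)) (i j : ℕ) : ℤ :=
  (Module.finrank K (forms K i j) : ℤ) - (Module.finrank K (piece X i j) : ℤ)

/-- A set of `r` points is generic if `H_X(i,j) = min {(i+1)(j+1), r}` for all `i, j ≥ 0`. -/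
def IsGeneric (X : Finset (Pt K)) : Prop :=
  ∀ i j : ℕ, hilbertFunction X i j = min (((i : ℤ) + 1) * ((j : ℤ) + 1)) (X.card : ℤ)

/-- The subring `K[s,t]` of `K[s,t,u,v]`. -/
noncomputable def stRing (K : Type*) [Field K] : Subalgebra K (Cox K) :=
  Algebra.adjoin K {varS, varT}

/-- The values at a point of `ℙ¹ × ℙ¹` (through a choice of homogeneous coordinates) of a
4-tuple of polynomials. -/
noncomputable def evalAt (f : Fin 4 → Cox K) (P : Pt K) : Fin 4 → K :=
  fun i => eval (Sum.elim P.1.rep P.2.rep) (f i)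

/-- The image in `ℙ³` of the rational map on `ℙ¹ × ℙ¹` given by four forms of one bidegree, on
the open set where they do not all vanish. -/
def imageSet (f : Fin 4 → Cox K) : Set (P3 K) :=
  {Q | ∃ (P : Pt K) (h : evalAt f P ≠ 0), Q = Projectivization.mk K (evalAt f P) h}

/-- The common zeros in `ℙ³` of a set of polynomials. -/
def zeros (J : Set (MvPolynomial (Fin 4) K)) : Set (P3 K) :=
  {Q | ∀ F ∈ J, ∀ (v : Fin 4 → K) (hv : v ≠ 0), Projectivization.mk K v hv = Q → eval v F = 0}

/-- The ideal of a subset of `ℙ³`: the polynomials that vanish at all homogeneous coordinates of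
all its points (a homogeneous ideal as soon as `K` is infinite). -/
def vanishing (Z : Set (P3 K)) : Ideal (MvPolynomial (Fin 4) K) where
  carrier := {F | ∀ (v : Fin 4 → K) (hv : v ≠ 0), Projectivization.mk K v hv ∈ Z → eval v F = 0}
  add_mem' := by
    intro F G hF hG v hv hZ
    rw [map_add, hF v hv hZ, hG v hv hZ, add_zero]
  zero_mem' := by
    intro v hv hZ
    exact map_zero _
  smul_mem' := by
    intro c F hF v hv hZ
    rw [smul_eq_mul, map_mul, hF v hv hZ, mul_zero]

/-- The tensor product surface `X_U` of the space `U` spanned by `f 0, …, f 3`: the Zariski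
closure of the image of the rational map given by `f`. -/
def surface (f : Fin 4 → Cox K) : Set (P3 K) :=
  zeros (vanishing (imageSet f) : Set (MvPolynomial (Fin 4) K))

variable (K) in
/-- The quadric `V(XW - YZ)` in `ℙ³`, where `X, Y, Z, W` are the coordinates `0, 1, 2, 3`. -/
def quadric : Set (P3 K) :=
  zeros {(X 0 * X 3 - X 1 * X 2 : MvPolynomial (Fin 4) K)}

/-- Smoothness over `K` of a Zariski closed subset of `ℙ³` with its reduced structure: each of
the four standard affine charts `xᵢ = 1` has a smooth coordinate ring over `K`. -/
def IsSmoothClosed (Z : Set (P3 K)) : Prop :=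
  ∀ i : Fin 4, Algebra.Smooth K
    (MvPolynomial (Fin 4) K ⧸ (vanishing Z ⊔ Ideal.span {(X i - 1 : MvPolynomial (Fin 4) K)}))

/-- The four products `s g₁, t g₁, s g₂, t g₂`. -/
noncomputable def products (g₁ g₂ : Cox K) : Fin 4 → Cox K :=
  ![varS * g₁, varT * g₁, varS * g₂, varT * g₂]

end TensorSurface

/-!
The map `(f, g) ↦ s f + t g` between the pieces `(I_X)_(i,1)` has as kernel a copy of
`(I_X)_(i-1,1)`, because a form whose products with `s` and `t` lie in `I_X` lies in `I_X`. For
`i ≥ k` the dimensions given by the Hilbert function then make it surjective, so `g₁` and `g₂`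
generate; comparing dimensions again, they have no syzygy over `K[s,t]`.

Write `g₁ = a₁ u + b₁ v` and `g₂ = a₂ u + b₂ v` with coefficients in `K[s,t]`. The rational map
given by `s g₁, t g₁, s g₂, t g₂` is the Segre embedding after the substitution `(g₁, g₂)` for
`(u, v)`, which is invertible wherever `a₁ b₂ - a₂ b₁` does not vanish; this determinant is not
zero, since otherwise `g₁` and `g₂` would have a syzygy. Hence the image is dense in the quadric,
whose ideal is the kernel of the Segre homomorphism.

Any affine chart of a linear transform of the quadric is the part of the quadric where some linear
form is `1`. It is formally smooth because one Newton step lifts a point modulo an ideal of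
square zero.
-/

namespace TensorSurface

section FormalSmoothness

universe u v

lemma exists_quadraticForm_eq_zero_polar_eq_one {B M : Type*} [CommRing B] [AddCommGroup M]
    [Module B M] (Q : QuadraticForm B M) {I : Ideal B} (hI : I ^ 2 = ⊥) {n m : M}
    (hm : Q m ∈ I) (hnm : QuadraticMap.polar Q n m - 1 ∈ I) :
    ∃ a ∈ I, ∃ b ∈ I, Q (a • n + (1 + b) • m) = 0 ∧
      QuadraticMap.polar Q n (a • n + (1 + b) • m) = 1 := by
  have mul_eq_zero_of_mem : ∀ x ∈ I, ∀ y ∈ I, x * y = 0 := fun x hx y hy => by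
    simpa only [← pow_two, hI, Ideal.mem_bot] using Ideal.mul_mem_mul hx hy
  obtain ⟨ε, hε⟩ : ∃ ε, ε = QuadraticMap.polar Q n m - 1 := ⟨_, rfl⟩
  rw [← hε] at hnm
  have hpolar : QuadraticMap.polar Q n m = 1 + ε := by rw [hε]; ring
  have hQQ := mul_eq_zero_of_mem _ hm _ hm
  have hQε := mul_eq_zero_of_mem _ hm _ hnm
  have hεε := mul_eq_zero_of_mem _ hnm _ hnm
  -- One Newton step along `n`, after rescaling `m` by `1 - ε`; the step is exact as `I ^ 2 = 0`.
  refine ⟨-Q m, neg_mem hm, 2 * Q n * Q m - ε, sub_mem (I.mul_mem_left _ hm) hnm, ?_, ?_⟩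
  · rw [QuadraticMap.map_add Q, QuadraticMap.map_smul, QuadraticMap.map_smul,
      QuadraticMap.polar_smul_left, QuadraticMap.polar_smul_right, hpolar]
    simp only [smul_eq_mul]
    linear_combination (Q n + 2 * Q n * (1 + (2 * Q n * Q m - ε))) * hQQ
      - 2 * (1 + (2 * Q n * Q m - ε)) * hQε
  · rw [QuadraticMap.polar_add_right, QuadraticMap.polar_smul_right, QuadraticMap.polar_smul_right,
      QuadraticMap.polar_self, hpolar]
    simp only [smul_eq_mul, nsmul_eq_mul, Nat.cast_ofNat]
    linear_combination 2 * Q n * hQε - hεε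

lemma formallySmooth_quotient_of_exists_lift {σ : Type u} {R : Type v} [CommRing R]
    (J : Ideal (MvPolynomial σ R))
    (h : ∀ (B : Type max u v) [CommRing B] [Algebra R B] (I : Ideal B), I ^ 2 = ⊥ →
      ∀ v : σ → B, (∀ F ∈ J, aeval v F ∈ I) →
        ∃ w : σ → B, (∀ i, w i - v i ∈ I) ∧ ∀ F ∈ J, aeval w F = 0) :
    Algebra.FormallySmooth R (MvPolynomial σ R ⧸ J) := by
  refine Algebra.FormallySmooth.of_comp_surjective fun B _ _ I hI f => ?_
  choose v hv using fun i => Ideal.Quotient.mk_surjective (f (Ideal.Quotient.mk J (X i)))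
  have mk_comp_aeval : (Ideal.Quotient.mkₐ R I).comp (aeval v) = f.comp (Ideal.Quotient.mkₐ R J) :=
    MvPolynomial.algHom_ext fun i => by simpa using hv i
  have aeval_mem : ∀ F ∈ J, aeval v F ∈ I := fun F hF => by
    have hF' : Ideal.Quotient.mk I (aeval v F) = f (Ideal.Quotient.mk J F) :=
      congr($mk_comp_aeval F)
    rwa [Ideal.Quotient.eq_zero_iff_mem.mpr hF, map_zero, Ideal.Quotient.eq_zero_iff_mem] at hF'
  obtain ⟨w, hwv, hw⟩ := h B I hI v aeval_mem
  refine ⟨Ideal.Quotient.liftₐ J (aeval w) hw, Ideal.Quotient.algHom_ext _ <|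
    MvPolynomial.algHom_ext fun i => ?_⟩
  change Ideal.Quotient.mk I (aeval w (X i)) = f (Ideal.Quotient.mk J (X i))
  rw [← hv i, aeval_X]
  exact Ideal.Quotient.eq.mpr (hwv i)

end FormalSmoothness

section LinearSubstitution

variable {R : Type*} [CommRing R] {n : Type*} [Fintype n]

lemma aeval_toMvPolynomial {m B : Type*} [CommRing B] [Algebra R B] (M : Matrix m n R) (i : m)
    (v : n → B) : aeval v (M.toMvPolynomial i) = ∑ j, algebraMap R B (M i j) * v j := by
  simp [Matrix.toMvPolynomial, aeval_monomial]

variable [DecidableEq n]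

lemma bind₁_toMvPolynomial_comp_of_mul_eq_one {M N : Matrix n n R} (h : N * M = 1) :
    (bind₁ M.toMvPolynomial).comp (bind₁ N.toMvPolynomial) = AlgHom.id R (MvPolynomial n R) :=
  MvPolynomial.algHom_ext fun i => by
    rw [AlgHom.comp_apply, bind₁_X_right, ← Matrix.toMvPolynomial_mul, h, Matrix.toMvPolynomial_one,
      AlgHom.id_apply]

/-- The automorphism of the polynomial ring that substitutes the coordinates of `e x` for the
coordinates of `x`, i.e. composition of polynomial functions with `e`. -/
noncomputable def linSubst (e : (n → R) ≃ₗ[R] (n → R)) : MvPolynomial n R ≃ₐ[R] MvPolynomial n R :=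
  AlgEquiv.ofAlgHom (bind₁ (LinearMap.toMatrix' e.toLinearMap).toMvPolynomial)
    (bind₁ (LinearMap.toMatrix' e.symm.toLinearMap).toMvPolynomial)
    (bind₁_toMvPolynomial_comp_of_mul_eq_one (by simp [← LinearMap.toMatrix'_comp]))
    (bind₁_toMvPolynomial_comp_of_mul_eq_one (by simp [← LinearMap.toMatrix'_comp]))

lemma linSubst_X (e : (n → R) ≃ₗ[R] (n → R)) (i : n) :
    linSubst e (X i) = (LinearMap.toMatrix' e.toLinearMap).toMvPolynomial i :=
  bind₁_X_right _ _

lemma eval_linSubst (e : (n → R) ≃ₗ[R] (n → R)) (v : n → R) (F : MvPolynomial n R) :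
    eval v (linSubst e F) = eval (e v) F := by
  change eval v (bind₁ _ F) = _
  rw [eval, eval₂Hom_bind₁]
  congr 2
  funext i
  exact (Matrix.toMvPolynomial_eval_eq_apply _ i v).trans
    (congrFun (LinearMap.toMatrix'_mulVec e.toLinearMap v) i)

end LinearSubstitution

variable {K : Type*} [Field K]

lemma zeros_span (J : Set (MvPolynomial (Fin 4) K)) :
    zeros (Ideal.span J : Set (MvPolynomial (Fin 4) K)) = zeros J := by
  refine Set.Subset.antisymm (fun Q hQ F hF => hQ F (Ideal.subset_span hF)) ?_
  intro Q hQ F hF v hv hvQ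
  have span_le_ker : Ideal.span J ≤ RingHom.ker (eval v) :=
    Ideal.span_le.mpr fun G hG => hQ G hG v hv hvQ
  exact span_le_ker hF

section ProjectiveTransformation

/-- The projective transformation induced by a linear automorphism. -/
abbrev projMap {V : Type*} [AddCommGroup V] [Module K V] (e : V ≃ₗ[K] V) :
    Projectivization K V → Projectivization K V :=
  Projectivization.map e.toLinearMap e.injective

lemma projMap_mk_symm {V : Type*} [AddCommGroup V] [Module K V] (e : V ≃ₗ[K] V) {v : V}
    (hv : v ≠ 0) : projMap e (Projectivization.mk K (e.symm v) (e.symm.map_ne_zero_iff.mpr hv)) =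
      Projectivization.mk K v hv := by
  simp [projMap, Projectivization.map_mk]

lemma projMap_injective {V : Type*} [AddCommGroup V] [Module K V] (e : V ≃ₗ[K] V) :
    Function.Injective (projMap e) :=
  Projectivization.map_injective _ e.injective

lemma vanishing_projMap_image (e : (Fin 4 → K) ≃ₗ[K] (Fin 4 → K)) (Z : Set (P3 K)) :
    vanishing (projMap e '' Z) = (vanishing Z).comap (linSubst e) := by
  ext F
  constructor
  · intro h v hv hZ
    rw [eval_linSubst]
    exact h (e v) (e.map_ne_zero_iff.mpr hv) ⟨_, hZ, rfl⟩
  · intro h v hv hZ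
    rw [← projMap_mk_symm e hv, (projMap_injective e).mem_set_image] at hZ
    simpa [eval_linSubst] using h _ _ hZ

lemma projMap_mem_zeros_comap_iff (e : (Fin 4 → K) ≃ₗ[K] (Fin 4 → K))
    (J : Ideal (MvPolynomial (Fin 4) K)) (Q : P3 K) :
    projMap e Q ∈ zeros (J.comap (linSubst e) : Set (MvPolynomial (Fin 4) K)) ↔
      Q ∈ zeros (J : Set (MvPolynomial (Fin 4) K)) := by
  constructor
  · rintro h F hF v hv rfl
    have hF' : (linSubst e).symm F ∈ J.comap (linSubst e) := by simpa using hF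
    simpa [← eval_linSubst] using h _ hF' (e v) (e.map_ne_zero_iff.mpr hv) rfl
  · intro h F hF v hv hvQ
    rw [← projMap_mk_symm e hv, (projMap_injective e).eq_iff] at hvQ
    simpa [eval_linSubst] using h _ hF _ _ hvQ

lemma zeros_vanishing_projMap_image (e : (Fin 4 → K) ≃ₗ[K] (Fin 4 → K)) (Z : Set (P3 K)) :
    zeros (vanishing (projMap e '' Z) : Set (MvPolynomial (Fin 4) K)) =
      projMap e '' zeros (vanishing Z : Set (MvPolynomial (Fin 4) K)) := by
  rw [vanishing_projMap_image]
  ext Q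
  obtain ⟨Q, rfl⟩ : ∃ Q', projMap e Q' = Q := by
    induction Q using Projectivization.ind with
    | h v hv => exact ⟨_, projMap_mk_symm e hv⟩
  rw [projMap_mem_zeros_comap_iff, (projMap_injective e).mem_set_image]

variable {f p : Fin 4 → Cox K} {e : (Fin 4 → K) ≃ₗ[K] (Fin 4 → K)}

lemma evalAt_linear_change (h : ∀ i, f i = ∑ j, LinearMap.toMatrix' e.toLinearMap i j • p j)
    (P : Pt K) : evalAt f P = e (evalAt p P) := by
  rw [← LinearEquiv.coe_coe, ← LinearMap.toMatrix'_mulVec]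
  funext i
  simp [evalAt, h, Matrix.mulVec, dotProduct, smul_eval]

lemma imageSet_linear_change
    (h : ∀ i, f i = ∑ j, LinearMap.toMatrix' e.toLinearMap i j • p j) :
    imageSet f = projMap e '' imageSet p := by
  have he := evalAt_linear_change h
  ext Q
  constructor
  · rintro ⟨P, hP, rfl⟩
    have hP' : evalAt p P ≠ 0 := by simpa only [he, e.map_ne_zero_iff] using hP
    exact ⟨_, ⟨P, hP', rfl⟩, by simp [projMap, Projectivization.map_mk, he]⟩
  · rintro ⟨_, ⟨P, hP, rfl⟩, rfl⟩
    exact ⟨P, by simpa only [he, ne_eq, e.map_eq_zero_iff] using hP,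
      by simp [projMap, Projectivization.map_mk, he]⟩

lemma surface_linear_change
    (h : ∀ i, f i = ∑ j, LinearMap.toMatrix' e.toLinearMap i j • p j) :
    surface f = projMap e '' surface p := by
  rw [surface, imageSet_linear_change h, zeros_vanishing_projMap_image, ← surface]

lemma exists_linearEquiv_of_span_eq {V ι : Type*} [AddCommGroup V] [Module K V] [Fintype ι]
    [DecidableEq ι] {f p : ι → V} (hf : LinearIndependent K f)
    (hfp : Submodule.span K (Set.range f) ≤ Submodule.span K (Set.range p)) :
    ∃ e : (ι → K) ≃ₗ[K] (ι → K), ∀ i, f i = ∑ j, LinearMap.toMatrix' e.toLinearMap i j • p j := by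
  choose M hM using fun i =>
    (Submodule.mem_span_range_iff_exists_fun K).mp (hfp (Submodule.subset_span ⟨i, rfl⟩))
  have linearIndependent_rows : LinearIndependent K (Matrix.of M).row := by
    have hfM : f = Fintype.linearCombination K p ∘ (Matrix.of M).row := funext fun i => (hM i).symm
    exact (hfM ▸ hf).of_comp _
  obtain ⟨_⟩ :=
    (Matrix.linearIndependent_rows_iff_isUnit.mp linearIndependent_rows).nonempty_invertible
  refine ⟨(Matrix.of M).toLinearEquiv' inferInstance, fun i => ?_⟩
  rw [Matrix.toLinearEquiv'_apply, LinearMap.toMatrix'_toLin']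
  exact (hM i).symm

end ProjectiveTransformation

section Quadric

variable (K) in
/-- The polynomial `XW - YZ` defining `quadric`. -/
noncomputable def quadricPoly : MvPolynomial (Fin 4) K := X 0 * X 3 - X 1 * X 2

/-- The quadratic form `XW - YZ` over an arbitrary commutative ring. -/
def quadricForm (B : Type*) [CommRing B] : QuadraticForm B (Fin 4 → B) :=
  QuadraticMap.linMulLin (LinearMap.proj 0) (LinearMap.proj 3) -
    QuadraticMap.linMulLin (LinearMap.proj 1) (LinearMap.proj 2)

lemma aeval_quadricPoly {B : Type*} [CommRing B] [Algebra K B] (v : Fin 4 → B) :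
    aeval v (quadricPoly K) = quadricForm B v := by
  simp [quadricPoly, quadricForm]

lemma polar_quadricForm {B : Type*} [CommRing B] (c v : Fin 4 → B) :
    QuadraticMap.polar (quadricForm B) ![c 3, -c 2, -c 1, c 0] v = ∑ j, c j * v j := by
  simp only [QuadraticMap.polar, quadricForm, sub_apply, QuadraticMap.linMulLin_apply,
    LinearMap.proj_apply, Pi.add_apply, Matrix.cons_val, Fin.sum_univ_four]
  ring

lemma smooth_hyperplane_complement_quadric {m : Type*} (M : Matrix m (Fin 4) K) (i : m) :
    Algebra.Smooth K (MvPolynomial (Fin 4) K ⧸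
      (Ideal.span {quadricPoly K} ⊔ Ideal.span {M.toMvPolynomial i - 1})) := by
  rw [← Ideal.span_union, Set.singleton_union]
  refine ⟨formallySmooth_quotient_of_exists_lift _ fun B _ _ I hI v hv => ?_,
    Algebra.FinitePresentation.of_finiteType.mp inferInstance⟩
  let n : Fin 4 → B := ![algebraMap K B (M i 3), -algebraMap K B (M i 2),
    -algebraMap K B (M i 1), algebraMap K B (M i 0)]
  have aeval_linear (w : Fin 4 → B) :
      aeval w (M.toMvPolynomial i - 1) = QuadraticMap.polar (quadricForm B) n w - 1 := by
    rw [map_sub, map_one, aeval_toMvPolynomial,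
      ← polar_quadricForm (fun j => algebraMap K B (M i j))]
  obtain ⟨a, ha, b, hb, hQ, hn⟩ := exists_quadraticForm_eq_zero_polar_eq_one (quadricForm B) hI
    (aeval_quadricPoly (K := K) v ▸ hv _ (Ideal.subset_span (by simp)))
    (aeval_linear v ▸ hv _ (Ideal.subset_span (by simp)))
  refine ⟨a • n + (1 + b) • v, fun j => ?_, fun F hF => ?_⟩
  · have h_diff : (a • n + (1 + b) • v) j - v j = n j * a + v j * b := by
      simp only [Pi.add_apply, Pi.smul_apply, smul_eq_mul]
      ring
    exact h_diff ▸ add_mem (I.mul_mem_left _ ha) (I.mul_mem_left _ hb)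
  · have span_le_ker : Ideal.span {quadricPoly K, M.toMvPolynomial i - 1} ≤
        RingHom.ker (aeval (R := K) (a • n + (1 + b) • v)) := by
      rw [Ideal.span_le]
      rintro _ (rfl | rfl)
      · exact (aeval_quadricPoly _).trans hQ
      · exact (aeval_linear _).trans (sub_eq_zero.mpr hn)
    exact span_le_ker hF

lemma mk_mem_quadric_iff {v : Fin 4 → K} (hv : v ≠ 0) :
    Projectivization.mk K v hv ∈ quadric K ↔ v 0 * v 3 = v 1 * v 2 := by
  constructor
  · intro h
    simpa [sub_eq_zero] using h _ rfl v hv rfl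
  · rintro h F rfl w hw hvw
    obtain ⟨a, rfl⟩ := (Projectivization.mk_eq_mk_iff' K w v hw hv).mp hvw
    simp only [map_sub, map_mul, eval_X, Pi.smul_apply, smul_eq_mul]
    linear_combination a ^ 2 * h

end Quadric

section Segre

/-- The Segre parametrization of the quadric `XW = YZ`, in homogeneous coordinates. The order of
the coordinates is that of `products`, with `y` in the place of `(g₁, g₂)`. -/
def segre (x y : Fin 2 → K) : Fin 4 → K := ![x 0 * y 0, x 1 * y 0, x 0 * y 1, x 1 * y 1]

lemma segre_smul_right (c : K) (x y : Fin 2 → K) : segre x (c • y) = c • segre x y := by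
  funext i
  fin_cases i <;> simp [segre, mul_left_comm]

lemma segre_ne_zero {x y : Fin 2 → K} (hx : x ≠ 0) (hy : y ≠ 0) : segre x y ≠ 0 := by
  obtain ⟨i, hi⟩ := Function.ne_iff.mp hx
  obtain ⟨j, hj⟩ := Function.ne_iff.mp hy
  intro h
  have h_entry : x i * y j = 0 := by
    have h0 := congrFun h 0
    have h1 := congrFun h 1
    have h2 := congrFun h 2
    have h3 := congrFun h 3
    fin_cases i <;> fin_cases j <;> assumption
  exact mul_ne_zero hi hj h_entry

lemma mk_segre_mem_quadric {x y : Fin 2 → K} (h : segre x y ≠ 0) :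
    Projectivization.mk K (segre x y) h ∈ quadric K := by
  rw [mk_mem_quadric_iff]
  simp only [segre, Matrix.cons_val]
  ring

variable (K) in
/-- The Segre parametrization as a homomorphism of coordinate rings. -/
noncomputable def segreHom : MvPolynomial (Fin 4) K →ₐ[K] Cox K :=
  aeval (products (X (Sum.inr 0)) (X (Sum.inr 1)))

lemma eval_products (g₁ g₂ : Cox K) (x y : Fin 2 → K) (i : Fin 4) :
    eval (Sum.elim x y) (products g₁ g₂ i) =
      segre x ![eval (Sum.elim x y) g₁, eval (Sum.elim x y) g₂] i := by
  fin_cases i <;> simp [products, segre, varS, varT]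

lemma eval_segreHom (x y : Fin 2 → K) (F : MvPolynomial (Fin 4) K) :
    eval (Sum.elim x y) (segreHom K F) = eval (segre x y) F := by
  suffices h : (aeval (Sum.elim x y)).comp (segreHom K) = aeval (segre x y) from congr($h F)
  refine MvPolynomial.algHom_ext fun i => ?_
  rw [AlgHom.comp_apply, segreHom, aeval_X, aeval_X]
  simpa [segre, aeval_eq_eval] using eval_products (X (Sum.inr 0)) (X (Sum.inr 1)) x y i

/-- The `K`-linear section of `segreHom`, modulo the equation of the quadric, that writes a monomial
`s ^ a * t ^ b * u ^ c * v ^ d` with `a + b = c + d` in the products `su, tu, sv, tv` without using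
both `tu` and `sv`. Its values on the other monomials are junk. -/
noncomputable def segreSection :
    Cox K →ₗ[K] MvPolynomial (Fin 4) K ⧸ Ideal.span {quadricPoly K} :=
  (basisMonomials (Fin 2 ⊕ Fin 2) K).constr K fun d =>
    let a := d (Sum.inl 0)
    let b := d (Sum.inl 1)
    let c := d (Sum.inr 0)
    Ideal.Quotient.mk _ (X 0 ^ min a c * X 1 ^ (c - a) * X 2 ^ (a - c) * X 3 ^ (b - (c - a)))

lemma segreSection_monomial (d : Fin 2 ⊕ Fin 2 →₀ ℕ) :
    segreSection (K := K) (monomial d 1) = Ideal.Quotient.mk _ (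
      X 0 ^ min (d (.inl 0)) (d (.inr 0)) * X 1 ^ (d (.inr 0) - d (.inl 0)) *
      X 2 ^ (d (.inl 0) - d (.inr 0)) *
      X 3 ^ (d (.inl 1) - (d (.inr 0) - d (.inl 0)))) :=
  (basisMonomials (Fin 2 ⊕ Fin 2) K).constr_basis K _ d

lemma segreHom_monomial (d : Fin 4 →₀ ℕ) :
    segreHom K (monomial d 1) = monomial (Finsupp.equivFunOnFinite.symm
      (Sum.elim ![d 0 + d 2, d 1 + d 3] ![d 0 + d 1, d 2 + d 3])) 1 := by
  rw [segreHom, aeval_monomial, monomial_eq, Finsupp.prod_fintype _ _ (by simp),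
    Finsupp.prod_fintype _ _ (by simp)]
  simp only [algebraMap_eq, C_1, one_mul, products, varS, varT, Fin.prod_univ_four,
    Fintype.prod_sum_type, Fin.prod_univ_two, Finsupp.equivFunOnFinite_symm_apply_apply,
    Sum.elim_inl, Sum.elim_inr, Matrix.cons_val]
  ring

lemma monomial_eq_of_mul_eq_mul {A : Type*} [CommRing A] {y : Fin 4 → A}
    (h : y 0 * y 3 = y 1 * y 2) {p b c : ℕ} (hb : p ≤ b) (hc : p ≤ c) (a d : ℕ) :
    y 0 ^ (a + p) * y 1 ^ (b - p) * y 2 ^ (c - p) * y 3 ^ (d + p) =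
      y 0 ^ a * y 1 ^ b * y 2 ^ c * y 3 ^ d := by
  obtain ⟨b, rfl⟩ := Nat.exists_eq_add_of_le hb
  obtain ⟨c, rfl⟩ := Nat.exists_eq_add_of_le hc
  rw [Nat.add_sub_cancel_left, Nat.add_sub_cancel_left]
  linear_combination (y 0 ^ a * y 1 ^ b * y 2 ^ c * y 3 ^ d) * congr($h ^ p)

lemma segreSection_segreHom (F : MvPolynomial (Fin 4) K) :
    segreSection (segreHom K F) = Ideal.Quotient.mk (Ideal.span {quadricPoly K}) F := by
  suffices h : segreSection ∘ₗ (segreHom K).toLinearMap =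
      (Ideal.Quotient.mkₐ K (Ideal.span {quadricPoly K})).toLinearMap from congr($h F)
  refine (basisMonomials (Fin 4) K).ext fun d => ?_
  change segreSection (segreHom K (monomial d 1)) = Ideal.Quotient.mk _ (monomial d 1)
  have quadric_relation := Ideal.Quotient.eq.mpr (Ideal.subset_span (Set.mem_singleton
    (quadricPoly K)))
  rw [map_mul, map_mul] at quadric_relation
  have normal_form := monomial_eq_of_mul_eq_mul (y := fun i => Ideal.Quotient.mk _ (X i))
    quadric_relation (min_le_left (d 1) (d 2)) (min_le_right (d 1) (d 2)) (d 0) (d 3)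
  rw [segreHom_monomial, segreSection_monomial, monomial_eq, Finsupp.prod_fintype _ _ (by simp)]
  have h_exponents : min (d 0 + d 2) (d 0 + d 1) = d 0 + min (d 1) (d 2) ∧
      d 0 + d 1 - (d 0 + d 2) = d 1 - min (d 1) (d 2) ∧
      d 0 + d 2 - (d 0 + d 1) = d 2 - min (d 1) (d 2) ∧
      d 1 + d 3 - (d 1 - min (d 1) (d 2)) = d 3 + min (d 1) (d 2) := by omega
  simp [h_exponents, Fin.prod_univ_four, normal_form]

lemma ker_segreHom : RingHom.ker (segreHom K) = Ideal.span {quadricPoly K} := by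
  refine le_antisymm (fun F hF => ?_) ?_
  · rw [← Ideal.Quotient.eq_zero_iff_mem, ← segreSection_segreHom, RingHom.mem_ker.mp hF, map_zero]
  · rw [Ideal.span_singleton_le_iff_mem, RingHom.mem_ker]
    simp only [segreHom, quadricPoly, products, map_sub, map_mul, aeval_X, Matrix.cons_val]
    ring

lemma segreHom_eq_zero [Infinite K] {D : Cox K} (hD : D ≠ 0) {F : MvPolynomial (Fin 4) K}
    (h : ∀ x y, x ≠ 0 → y ≠ 0 → eval (Sum.elim x y) D ≠ 0 → eval (segre x y) F = 0) :
    segreHom K F = 0 := by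
  have X_inl_mul_X_inr_ne_zero : (X (Sum.inl 0) * X (Sum.inr 0) : Cox K) ≠ 0 :=
    mul_ne_zero (X_ne_zero _) (X_ne_zero _)
  suffices h0 : segreHom K F * (D * (X (Sum.inl 0) * X (Sum.inr 0))) = 0 from
    (mul_eq_zero_iff_right (mul_ne_zero hD X_inl_mul_X_inr_ne_zero)).mp h0
  refine MvPolynomial.funext fun z => ?_
  obtain ⟨x, y, rfl⟩ : ∃ x y : Fin 2 → K, Sum.elim x y = z :=
    ⟨_, _, Sum.elim_comp_inl_inr z⟩
  rw [map_mul, map_mul, map_mul, eval_X, eval_X, map_zero, Sum.elim_inl, Sum.elim_inr,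
    eval_segreHom]
  by_contra hne
  obtain ⟨hF, hDxy, hx, hy⟩ := by simpa only [mul_eq_zero, not_or] using hne
  exact hF (h x y (Function.ne_iff.mpr ⟨0, hx⟩) (Function.ne_iff.mpr ⟨0, hy⟩) hDxy)

lemma vanishing_eq_span_quadricPoly [Infinite K] {Z : Set (P3 K)} (hZ : Z ⊆ quadric K) {D : Cox K}
    (hD : D ≠ 0) (h : ∀ (x y : Fin 2 → K) (hx : x ≠ 0) (hy : y ≠ 0), eval (Sum.elim x y) D ≠ 0 →
      Projectivization.mk K (segre x y) (segre_ne_zero hx hy) ∈ Z) :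
    vanishing Z = Ideal.span {quadricPoly K} := by
  refine le_antisymm (fun F hF => ?_) ?_
  · rw [← ker_segreHom]
    exact segreHom_eq_zero hD fun x y hx hy hDxy => hF _ _ (h x y hx hy hDxy)
  · rw [Ideal.span_singleton_le_iff_mem]
    exact fun v hv hvZ => hZ hvZ _ rfl v hv rfl

lemma vanishing_quadric [Infinite K] : vanishing (quadric K) = Ideal.span {quadricPoly K} :=
  vanishing_eq_span_quadricPoly subset_rfl one_ne_zero fun _ _ _ _ _ => mk_segre_mem_quadric _

end Segre

lemma isSmoothClosed_projMap_image_quadric [Infinite K] (e : (Fin 4 → K) ≃ₗ[K] (Fin 4 → K)) :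
    IsSmoothClosed (projMap e '' quadric K) := by
  intro i
  let M := LinearMap.toMatrix' e.toLinearMap
  have := smooth_hyperplane_complement_quadric M i
  let φ := Ideal.quotientEquivAlg
    ((vanishing (projMap e '' quadric K)) ⊔ Ideal.span {(X i - 1 : MvPolynomial (Fin 4) K)})
    (Ideal.span {quadricPoly K} ⊔ Ideal.span {M.toMvPolynomial i - 1}) (linSubst e) (by
      rw [vanishing_projMap_image, vanishing_quadric, Ideal.map_sup, Ideal.map_span,
        Set.image_singleton, Ideal.map_coe,
        Ideal.map_comap_of_surjective _ (linSubst e).surjective]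
      simp [linSubst_X, M])
  exact Algebra.Smooth.of_equiv φ.symm

lemma isSmoothClosed_quadric [Infinite K] : IsSmoothClosed (quadric K) := by
  simpa [projMap] using isSmoothClosed_projMap_image_quadric (LinearEquiv.refl K (Fin 4 → K))

section Forms

open Finset.HasAntidiagonal

lemma weight_bideg_eq_iff {d : Fin 2 ⊕ Fin 2 →₀ ℕ} {a b : ℕ} :
    Finsupp.weight bideg d = (a, b) ↔
      d (Sum.inl 0) + d (Sum.inl 1) = a ∧ d (Sum.inr 0) + d (Sum.inr 1) = b := by
  simp [Finsupp.weight_apply, Finsupp.sum_fintype, Fintype.sum_sum_type, bideg, Prod.ext_iff]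

lemma mem_forms {a b : ℕ} {f : Cox K} :
    f ∈ forms K a b ↔ ∀ d, coeff d f ≠ 0 →
      d (Sum.inl 0) + d (Sum.inl 1) = a ∧ d (Sum.inr 0) + d (Sum.inr 1) = b := by
  simp only [forms, mem_weightedHomogeneousSubmodule, IsWeightedHomogeneous, weight_bideg_eq_iff]

lemma mul_mem_forms {a b a' b' : ℕ} {f g : Cox K} (hf : f ∈ forms K a b)
    (hg : g ∈ forms K a' b') : f * g ∈ forms K (a + a') (b + b') :=
  IsWeightedHomogeneous.mul hf hg

lemma X_inl_mem_forms (i : Fin 2) : (X (Sum.inl i) : Cox K) ∈ forms K 1 0 :=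
  isWeightedHomogeneous_X K bideg (Sum.inl i)

lemma mem_forms_of_X_inl_mul_mem {a b : ℕ} {i : Fin 2} {h : Cox K}
    (hh : X (Sum.inl i) * h ∈ forms K (a + 1) b) : h ∈ forms K a b := by
  rw [mem_forms] at hh ⊢
  intro d hd
  have h_deg := hh (Finsupp.single (Sum.inl i) 1 + d) (by rwa [coeff_X_mul])
  fin_cases i <;>
  · simp only [Finsupp.add_apply, Finsupp.single_apply, Sum.inl.injEq, reduceCtorEq, reduceIte,
      Fin.zero_eta, Fin.mk_one, zero_ne_one, one_ne_zero] at h_deg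
    omega

lemma eq_zero_of_X_inl_mul_mem {b : ℕ} {i : Fin 2} {h : Cox K}
    (hh : X (Sum.inl i) * h ∈ forms K 0 b) : h = 0 := by
  by_contra h_ne
  obtain ⟨d, hd⟩ := ne_zero_iff.mp h_ne
  have h_deg := mem_forms.mp hh (Finsupp.single (Sum.inl i) 1 + d) (by rwa [coeff_X_mul])
  fin_cases i <;> simp at h_deg

/-- The exponents of the monomials of bidegree `(a, b)`, as pairs of exponents of `s, t` and of
`u, v`; this counts them. -/
noncomputable def formsExponents (a b : ℕ) :
    {d : Fin 2 ⊕ Fin 2 →₀ ℕ | Finsupp.weight bideg d = (a, b)} ≃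
      antidiagonal a × antidiagonal b where
  toFun d := (⟨(d.1 (Sum.inl 0), d.1 (Sum.inl 1)), by simpa using (weight_bideg_eq_iff.mp d.2).1⟩,
    ⟨(d.1 (Sum.inr 0), d.1 (Sum.inr 1)), by simpa using (weight_bideg_eq_iff.mp d.2).2⟩)
  invFun p := ⟨Finsupp.equivFunOnFinite.symm (Sum.elim ![p.1.1.1, p.1.1.2] ![p.2.1.1, p.2.1.2]),
    weight_bideg_eq_iff.mpr ⟨mem_antidiagonal.mp p.1.2, mem_antidiagonal.mp p.2.2⟩⟩
  left_inv d := by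
    ext (i | i) <;> fin_cases i <;> rfl
  right_inv p := rfl

/-- The coordinates of forms of bidegree `(a, b)` in the basis of monomials. -/
noncomputable def formsEquiv (a b : ℕ) : forms K a b ≃ₗ[K]
    (antidiagonal a × antidiagonal b →₀ K) :=
  (LinearEquiv.ofEq _ _ (weightedHomogeneousSubmodule_eq_finsupp_supported K bideg (a, b))).trans
    ((AddMonoidAlgebra.supportedEquivFinsupp _).trans (Finsupp.domLCongr (formsExponents a b)))

instance (a b : ℕ) : FiniteDimensional K (forms K a b) :=
  Module.Finite.equiv (formsEquiv a b).symm

lemma finrank_forms (a b : ℕ) : Module.finrank K (forms K a b) = (a + 1) * (b + 1) := by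
  rw [(formsEquiv a b).finrank_eq, Module.finrank_finsupp_self, Fintype.card_prod,
    Fintype.card_coe, Fintype.card_coe, Finset.Nat.card_antidiagonal, Finset.Nat.card_antidiagonal]

lemma coeff_divMonomial_single_mul_X {σ R : Type*} [CommSemiring R]
    (f : MvPolynomial σ R) (i : σ) (d : σ →₀ ℕ) :
    coeff d (f.divMonomial (Finsupp.single i 1) * X i) = if d i = 0 then 0 else coeff d f := by
  classical
  rw [coeff_mul_X', ← ite_not]
  simp only [Finsupp.mem_support_iff, not_not]
  split_ifs with h
  · rfl
  · rw [coeff_divMonomial, add_tsub_cancel_of_le]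
    rwa [Finsupp.single_le_iff, Nat.one_le_iff_ne_zero]

lemma divMonomial_single_inr_mem_forms {a b : ℕ} {g : Cox K} (hg : g ∈ forms K a (b + 1))
    (j : Fin 2) : g.divMonomial (Finsupp.single (Sum.inr j) 1) ∈ forms K a b := by
  rw [mem_forms] at hg ⊢
  intro d hd
  rw [coeff_divMonomial] at hd
  have h_deg := hg _ hd
  fin_cases j <;>
  · simp only [Finsupp.add_apply, Finsupp.single_apply, Sum.inr.injEq, reduceCtorEq, reduceIte,
      Fin.zero_eta, Fin.mk_one, zero_ne_one, one_ne_zero] at h_deg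
    omega

lemma exists_eq_of_mem_forms_one {a : ℕ} {g : Cox K} (hg : g ∈ forms K a 1) :
    ∃ p ∈ forms K a 0, ∃ q ∈ forms K a 0, g = p * X (Sum.inr 0) + q * X (Sum.inr 1) := by
  refine ⟨_, divMonomial_single_inr_mem_forms hg 0, _, divMonomial_single_inr_mem_forms hg 1, ?_⟩
  ext d
  rw [coeff_add, coeff_divMonomial_single_mul_X, coeff_divMonomial_single_mul_X]
  by_cases hd : coeff d g = 0
  · simp [hd]
  · have h_deg := (mem_forms.mp hg d hd).2
    rcases Nat.eq_zero_or_pos (d (Sum.inr 0)) with h0 | h0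
    · rw [if_pos h0, if_neg (by omega), zero_add]
    · rw [if_neg h0.ne', if_pos (by omega), add_zero]

lemma eval_smul_forms {a b : ℕ} {f : Cox K} (hf : f ∈ forms K a b) (l m : K) (x y : Fin 2 → K) :
    eval (Sum.elim (l • x) (m • y)) f = l ^ a * m ^ b * eval (Sum.elim x y) f := by
  rw [eval_eq', eval_eq', Finset.mul_sum]
  refine Finset.sum_congr rfl fun d hd => ?_
  obtain ⟨rfl, rfl⟩ := mem_forms.mp hf d (mem_support_iff.mp hd)
  simp only [Fintype.prod_sum_type, Sum.elim_inl, Sum.elim_inr, Fin.prod_univ_two, Pi.smul_apply,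
    smul_eq_mul]
  ring

lemma eval_forms_zero {a : ℕ} {f : Cox K} (hf : f ∈ forms K a 0) (x y y' : Fin 2 → K) :
    eval (Sum.elim x y) f = eval (Sum.elim x y') f := by
  have eval_eq_eval_zero (z : Fin 2 → K) :
      eval (Sum.elim x (0 : Fin 2 → K)) f = eval (Sum.elim x z) f := by
    simpa using eval_smul_forms hf 1 0 x z
  rw [← eval_eq_eval_zero, eval_eq_eval_zero]

end Forms

section PointIdeals

lemma sub_map_mem_of_X_sub_mem {σ R : Type*} [CommRing R] {J : Ideal (MvPolynomial σ R)}
    {φ : MvPolynomial σ R →ₐ[R] MvPolynomial σ R} (hφ : ∀ i, X i - φ (X i) ∈ J)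
    (F : MvPolynomial σ R) : F - φ F ∈ J := by
  suffices h : Ideal.Quotient.mkₐ R J = (Ideal.Quotient.mkₐ R J).comp φ from
    Ideal.Quotient.eq.mp congr($h F)
  exact MvPolynomial.algHom_ext fun i => Ideal.Quotient.eq.mpr (hφ i)

/-- Pullback of polynomials along `(X₀, X₁) ↦ (X₀ x, X₁ y)`, i.e. their restriction to the plane of
homogeneous coordinates of the point of `ℙ¹ × ℙ¹` represented by `(x, y)`. -/
noncomputable def restrictCone (x y : Fin 2 → K) : Cox K →ₐ[K] MvPolynomial (Fin 2) K :=
  aeval (Sum.elim (fun i => C (x i) * X 0) (fun i => C (y i) * X 1))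

lemma exists_dotProduct_eq_one {n : Type*} [Fintype n] {x : n → K} (hx : x ≠ 0) :
    ∃ c : n → K, c ⬝ᵥ x = 1 := by
  classical
  obtain ⟨i, hi⟩ := Function.ne_iff.mp hx
  exact ⟨Pi.single i (x i)⁻¹, by simpa using inv_mul_cancel₀ hi⟩

lemma sub_mul_dotProduct_mem {A : Type*} [CommRing A] {J : Ideal A} {x c z : Fin 2 → A}
    (hz : x 1 * z 0 - x 0 * z 1 ∈ J) (hc : c ⬝ᵥ x = 1) : ∀ i, z i - x i * (c ⬝ᵥ z) ∈ J := by
  rw [dotProduct, Fin.sum_univ_two] at hc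
  simp only [dotProduct, Fin.sum_univ_two]
  refine Fin.forall_fin_two.mpr ⟨?_, ?_⟩
  · convert J.mul_mem_left (c 1) hz using 1
    linear_combination -z 0 * hc
  · convert J.mul_mem_left (-c 0) hz using 1
    linear_combination -z 1 * hc

lemma pointIdeal_eq_ker (P : Pt K) :
    pointIdeal P = RingHom.ker (restrictCone P.1.rep P.2.rep) := by
  refine le_antisymm ?_ fun F hF => ?_
  · rw [pointIdeal, Ideal.span_le]
    rintro F (rfl | rfl) <;>
    · simp only [SetLike.mem_coe, RingHom.mem_ker, restrictCone, map_sub, map_mul, aeval_X,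
        Sum.elim_inl, Sum.elim_inr, algHom_C, algebraMap_eq]
      ring
  · obtain ⟨c, hc⟩ := exists_dotProduct_eq_one P.1.rep_nonzero
    obtain ⟨d, hd⟩ := exists_dotProduct_eq_one P.2.rep_nonzero
    have dotProduct_C {a b : Fin 2 → K} (h : a ⬝ᵥ b = 1) :
        (C ∘ a) ⬝ᵥ (C ∘ b) = (1 : Cox K) := by
      rw [← RingHom.map_dotProduct, h, C_1]
    -- Linear forms with value `1` at the representatives invert the parametrization of the cone.
    let split : MvPolynomial (Fin 2) K →ₐ[K] Cox K :=
      aeval ![(C ∘ c) ⬝ᵥ (X ∘ Sum.inl), (C ∘ d) ⬝ᵥ (X ∘ Sum.inr)]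
    have X_inl_sub_mem := sub_mul_dotProduct_mem (J := pointIdeal P) (x := C ∘ P.1.rep)
      (z := X ∘ Sum.inl) (Ideal.subset_span (by simp)) (dotProduct_C hc)
    have X_inr_sub_mem := sub_mul_dotProduct_mem (J := pointIdeal P) (x := C ∘ P.2.rep)
      (z := X ∘ Sum.inr) (Ideal.subset_span (by simp)) (dotProduct_C hd)
    have sub_split_mem : F - split (restrictCone P.1.rep P.2.rep F) ∈ pointIdeal P := by
      refine sub_map_mem_of_X_sub_mem (φ := split.comp (restrictCone P.1.rep P.2.rep)) ?_ F
      rintro (i | i)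
      · simpa [split, restrictCone] using X_inl_sub_mem i
      · simpa [split, restrictCone] using X_inr_sub_mem i
    rwa [RingHom.mem_ker.mp hF, map_zero, sub_zero] at sub_split_mem

lemma mem_pointIdeal_of_X_inl_mul_mem {P : Pt K} {h : Cox K}
    (hh : ∀ i, X (Sum.inl i) * h ∈ pointIdeal P) : h ∈ pointIdeal P := by
  obtain ⟨i, hi⟩ := Function.ne_iff.mp P.1.rep_nonzero
  have restrict_eq_zero := hh i
  simp only [pointIdeal_eq_ker, RingHom.mem_ker, map_mul] at restrict_eq_zero ⊢
  refine (mul_eq_zero.mp restrict_eq_zero).resolve_left ?_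
  simpa [restrictCone] using hi

lemma mem_pointsIdeal_of_X_inl_mul_mem {S : Finset (Pt K)} {h : Cox K}
    (hh : ∀ i, X (Sum.inl i) * h ∈ pointsIdeal S) : h ∈ pointsIdeal S := by
  simp only [pointsIdeal, Submodule.mem_iInf] at hh ⊢
  exact fun P hP => mem_pointIdeal_of_X_inl_mul_mem fun i => hh i P hP

end PointIdeals

section Pieces

variable {S : Finset (Pt K)} {a b : ℕ}

instance : FiniteDimensional K (piece S a b) :=
  Submodule.finiteDimensional_of_le (inf_le_right : piece S a b ≤ forms K a b)

lemma mul_mem_piece {d : ℕ} {p f : Cox K} (hp : p ∈ forms K d 0) (hf : f ∈ piece S a b) :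
    p * f ∈ piece S (a + d) b :=
  ⟨(pointsIdeal S).mul_mem_left p hf.1, by
    rw [add_comm a d, ← zero_add b]
    exact mul_mem_forms hp hf.2⟩

lemma X_inl_mul_mem_piece {f : Cox K} (i : Fin 2) (hf : f ∈ piece S a b) :
    X (Sum.inl i) * f ∈ piece S (a + 1) b :=
  mul_mem_piece (X_inl_mem_forms i) hf

lemma mem_piece_of_X_inl_mul_mem {h : Cox K} (hh : ∀ i, X (Sum.inl i) * h ∈ piece S (a + 1) b) :
    h ∈ piece S a b :=
  ⟨mem_pointsIdeal_of_X_inl_mul_mem fun i => (hh i).1, mem_forms_of_X_inl_mul_mem (hh 0).2⟩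

lemma exists_koszul_syzygy {R : Type*} [CommRing R] [IsDomain R] {s t f g : R} (ht : Prime t)
    (hts : ¬ t ∣ s) (h : s * f + t * g = 0) : ∃ r, f = t * r ∧ g = -(s * r) := by
  have t_dvd : t ∣ s * f := ⟨-g, by linear_combination h⟩
  obtain ⟨r, rfl⟩ := (ht.dvd_or_dvd t_dvd).resolve_left hts
  exact ⟨r, rfl, mul_left_cancel₀ ht.ne_zero (by linear_combination h)⟩

variable (S a b) in
/-- The multiplication `(f, g) ↦ s f + t g` between graded pieces of `I_X`. -/
noncomputable def mulST : (piece S a b × piece S a b) →ₗ[K] piece S (a + 1) b :=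
  LinearMap.coprod
    ((LinearMap.mulLeft K (X (Sum.inl 0))).restrict fun _ hf => X_inl_mul_mem_piece 0 hf)
    ((LinearMap.mulLeft K (X (Sum.inl 1))).restrict fun _ hf => X_inl_mul_mem_piece 1 hf)

variable (S a b) in
/-- The map `h ↦ (t h, -s h)` onto the syzygies of `s` and `t` in a graded piece of `I_X`. -/
noncomputable def syzygyMap : piece S a b →ₗ[K] (piece S (a + 1) b × piece S (a + 1) b) :=
  LinearMap.prod
    ((LinearMap.mulLeft K (X (Sum.inl 1))).restrict fun _ hf => X_inl_mul_mem_piece 1 hf)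
    (-((LinearMap.mulLeft K (X (Sum.inl 0))).restrict fun _ hf => X_inl_mul_mem_piece 0 hf))

lemma exists_of_mem_ker_mulST {p : piece S a b × piece S a b}
    (hp : p ∈ LinearMap.ker (mulST S a b)) :
    ∃ h, (∀ i, X (Sum.inl i) * h ∈ piece S a b) ∧
      (p.1 : Cox K) = X (Sum.inl 1) * h ∧ (p.2 : Cox K) = -(X (Sum.inl 0) * h) := by
  obtain ⟨h, h₁, h₂⟩ := exists_koszul_syzygy (X_prime (R := K)) (by simp [X_dvd_X])
    (congrArg Subtype.val (LinearMap.mem_ker.mp hp))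
  refine ⟨h, Fin.forall_fin_two.mpr ⟨?_, ?_⟩, h₁, h₂⟩
  · exact neg_mem_iff.mp (h₂ ▸ p.2.2)
  · exact h₁ ▸ p.1.2

lemma ker_mulST_zero : LinearMap.ker (mulST S 0 b) = ⊥ := by
  refine (Submodule.eq_bot_iff _).mpr fun p hp => ?_
  obtain ⟨h, h_mem, h₁, h₂⟩ := exists_of_mem_ker_mulST hp
  obtain rfl := eq_zero_of_X_inl_mul_mem (h_mem 0).2
  exact Prod.ext (Subtype.ext (by simpa using h₁)) (Subtype.ext (by simpa using h₂))

lemma ker_mulST_succ_le :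
    LinearMap.ker (mulST S (a + 1) b) ≤ LinearMap.range (syzygyMap S a b) := by
  intro p hp
  obtain ⟨h, h_mem, h₁, h₂⟩ := exists_of_mem_ker_mulST hp
  exact ⟨⟨h, mem_piece_of_X_inl_mul_mem h_mem⟩,
    Prod.ext (Subtype.ext h₁.symm) (Subtype.ext h₂.symm)⟩

lemma mulST_surjective
    (h : Module.finrank K (piece S (a + 1) b) + Module.finrank K (LinearMap.ker (mulST S a b)) ≤
      2 * Module.finrank K (piece S a b)) : Function.Surjective (mulST S a b) := by
  rw [← LinearMap.range_eq_top]
  apply Submodule.eq_top_of_finrank_eq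
  have rank_nullity := LinearMap.finrank_range_add_finrank_ker (mulST S a b)
  have finrank_range_le := Submodule.finrank_le (LinearMap.range (mulST S a b))
  rw [Module.finrank_prod] at rank_nullity
  omega

end Pieces

section HilbertFunction

variable {S : Finset (Pt K)} {k : ℕ}

lemma finrank_piece_one_of_hilbertFunction {i : ℕ}
    (h : hilbertFunction S i 1 = min (2 * ((i : ℤ) + 1)) (2 * k)) :
    Module.finrank K (piece S i 1) = 2 * (i + 1) - 2 * k := by
  rw [hilbertFunction, finrank_forms] at h
  push_cast at h
  omega

lemma piece_eq_bot (hdim : ∀ i, Module.finrank K (piece S i 1) = 2 * (i + 1) - 2 * k) {i : ℕ}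
    (hi : i < k) : piece S i 1 = ⊥ := by
  rw [← Submodule.finrank_eq_zero (R := K), hdim]
  omega

lemma finrank_ker_mulST_le (hdim : ∀ i, Module.finrank K (piece S i 1) = 2 * (i + 1) - 2 * k)
    (i : ℕ) : Module.finrank K (LinearMap.ker (mulST S i 1)) ≤ 2 * i - 2 * k := by
  cases i with
  | zero => rw [ker_mulST_zero, finrank_bot]; exact Nat.zero_le _
  | succ i =>
    calc Module.finrank K (LinearMap.ker (mulST S (i + 1) 1))
        ≤ Module.finrank K (LinearMap.range (syzygyMap S i 1)) :=
          Submodule.finrank_mono ker_mulST_succ_le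
      _ ≤ Module.finrank K (piece S i 1) := LinearMap.finrank_range_le _
      _ = 2 * (i + 1) - 2 * k := hdim i

lemma exists_of_mem_piece_succ
    (hdim : ∀ i, Module.finrank K (piece S i 1) = 2 * (i + 1) - 2 * k) {i : ℕ} (hi : k ≤ i)
    {f : Cox K} (hf : f ∈ piece S (i + 1) 1) :
    ∃ p ∈ piece S i 1, ∃ q ∈ piece S i 1, f = X (Sum.inl 0) * p + X (Sum.inl 1) * q := by
  have finrank_ker_le := finrank_ker_mulST_le hdim i
  have surjective : Function.Surjective (mulST S i 1) :=
    mulST_surjective (by rw [hdim, hdim]; omega)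
  obtain ⟨⟨p, q⟩, hpq⟩ := surjective ⟨f, hf⟩
  exact ⟨p, p.2, q, q.2, congrArg Subtype.val hpq.symm⟩

variable {g₁ g₂ : Cox K}

lemma exists_of_mem_piece (hdim : ∀ i, Module.finrank K (piece S i 1) = 2 * (i + 1) - 2 * k)
    (hg : Submodule.span K {g₁, g₂} = piece S k 1) (d : ℕ) {f : Cox K}
    (hf : f ∈ piece S (k + d) 1) :
    ∃ p ∈ forms K d 0, ∃ q ∈ forms K d 0, f = p * g₁ + q * g₂ := by
  induction d generalizing f with
  | zero =>
    rw [add_zero, ← hg, Submodule.mem_span_pair] at hf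
    obtain ⟨a, b, rfl⟩ := hf
    exact ⟨C a, isWeightedHomogeneous_C _ _, C b, isWeightedHomogeneous_C _ _, by
      rw [C_mul', C_mul']⟩
  | succ d ih =>
    obtain ⟨x, hx, y, hy, rfl⟩ := exists_of_mem_piece_succ hdim (Nat.le_add_right k d) hf
    obtain ⟨p, hp, q, hq, rfl⟩ := ih hx
    obtain ⟨p', hp', q', hq', rfl⟩ := ih hy
    have X_inl_mul_mem (i : Fin 2) {r : Cox K} (hr : r ∈ forms K d 0) :
        X (Sum.inl i) * r ∈ forms K (d + 1) 0 := by
      simpa only [zero_add, add_comm] using mul_mem_forms (X_inl_mem_forms i) hr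
    exact ⟨_, add_mem (X_inl_mul_mem 0 hp) (X_inl_mul_mem 1 hp'), _,
      add_mem (X_inl_mul_mem 0 hq) (X_inl_mul_mem 1 hq'), by ring⟩

lemma mem_piece_of_span_eq (hg : Submodule.span K {g₁, g₂} = piece S k 1) :
    g₁ ∈ piece S k 1 ∧ g₂ ∈ piece S k 1 := by
  rw [← hg]
  exact ⟨Submodule.subset_span (by simp), Submodule.subset_span (by simp)⟩

lemma eq_zero_of_syzygy (hdim : ∀ i, Module.finrank K (piece S i 1) = 2 * (i + 1) - 2 * k)
    (hg : Submodule.span K {g₁, g₂} = piece S k 1) {d : ℕ} {p q : Cox K}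
    (hp : p ∈ forms K d 0) (hq : q ∈ forms K d 0) (h : p * g₁ + q * g₂ = 0) :
    p = 0 ∧ q = 0 := by
  obtain ⟨hg₁, hg₂⟩ := mem_piece_of_span_eq hg
  let mulGens : (forms K d 0 × forms K d 0) →ₗ[K] piece S (k + d) 1 :=
    LinearMap.coprod
      ((LinearMap.mulRight K g₁).restrict fun _ hr => mul_mem_piece hr hg₁)
      ((LinearMap.mulRight K g₂).restrict fun _ hr => mul_mem_piece hr hg₂)
  have surjective : Function.Surjective mulGens := fun ⟨f, hf⟩ => by
    obtain ⟨p, hp, q, hq, hpq⟩ := exists_of_mem_piece hdim hg d hf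
    exact ⟨(⟨p, hp⟩, ⟨q, hq⟩), Subtype.ext hpq.symm⟩
  have injective : Function.Injective mulGens := by
    refine (LinearMap.injective_iff_surjective_of_finrank_eq_finrank ?_).mpr surjective
    rw [Module.finrank_prod, finrank_forms, hdim]
    omega
  have pq_eq_zero : ((⟨p, hp⟩, ⟨q, hq⟩) : forms K d 0 × forms K d 0) = 0 :=
    (map_eq_zero_iff mulGens injective).mp (Subtype.ext h)
  exact ⟨congr(($pq_eq_zero).1.1), congr(($pq_eq_zero).2.1)⟩

lemma smul_mem_of_mem_adjoin {R A M : Type*} [CommSemiring R] [Semiring A] [Algebra R A]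
    [AddCommMonoid M] [Module R M] [Module A M] [IsScalarTower R A M] {N : Submodule R M}
    {s : Set A} (hs : ∀ r ∈ s, ∀ m ∈ N, r • m ∈ N) {r : A} (hr : r ∈ Algebra.adjoin R s) {m : M}
    (hm : m ∈ N) : r • m ∈ N := by
  induction hr using Algebra.adjoin_induction generalizing m with
  | mem r hr => exact hs r hr m hm
  | algebraMap c => rw [algebraMap_smul]; exact N.smul_mem c hm
  | add x y _ _ hx hy => rw [add_smul]; exact add_mem (hx hm) (hy hm)
  | mul x y _ _ hx hy => rw [mul_smul]; exact hx (hy hm)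

lemma stRing_smul_mem_iSup_piece {r f : Cox K} {b : ℕ} (hr : r ∈ stRing K)
    (hf : f ∈ ⨆ i, piece S i b) : r * f ∈ ⨆ i, piece S i b := by
  have X_inl_mul_mem (j : Fin 2) :
      ∀ f ∈ ⨆ i, piece S i b, X (Sum.inl j) * f ∈ ⨆ i, piece S i b := by
    change _ ≤ Submodule.comap (LinearMap.mulLeft K (X (Sum.inl j))) (⨆ i, piece S i b)
    exact iSup_le fun i f hf => Submodule.mem_iSup_of_mem (i + 1) (X_inl_mul_mem_piece j hf)
  refine smul_mem_of_mem_adjoin ?_ hr hf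
  rintro _ (rfl | rfl)
  · exact X_inl_mul_mem 0
  · exact X_inl_mul_mem 1

lemma span_stRing_eq (hdim : ∀ i, Module.finrank K (piece S i 1) = 2 * (i + 1) - 2 * k)
    (hg : Submodule.span K {g₁, g₂} = piece S k 1) :
    (Submodule.span (stRing K) {g₁, g₂}).restrictScalars K = ⨆ i : ℕ, piece S i 1 := by
  apply le_antisymm
  · intro f hf
    rw [Submodule.restrictScalars_mem, Submodule.mem_span_pair] at hf
    obtain ⟨a, b, rfl⟩ := hf
    obtain ⟨hg₁, hg₂⟩ := mem_piece_of_span_eq hg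
    exact add_mem (stRing_smul_mem_iSup_piece a.2 (Submodule.mem_iSup_of_mem k hg₁))
      (stRing_smul_mem_iSup_piece b.2 (Submodule.mem_iSup_of_mem k hg₂))
  refine iSup_le fun i => ?_
  rcases lt_or_ge i k with hi | hi
  · exact (piece_eq_bot hdim hi).trans_le bot_le
  induction i, hi using Nat.le_induction with
  | base => exact hg ▸ Submodule.span_le.mpr Submodule.subset_span
  | succ i hi ih =>
    intro f hf
    obtain ⟨p, hp, q, hq, rfl⟩ := exists_of_mem_piece_succ hdim hi hf
    have hs : varS ∈ stRing K := Algebra.subset_adjoin (by simp)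
    have ht : varT ∈ stRing K := Algebra.subset_adjoin (by simp)
    exact add_mem (Submodule.smul_mem (Submodule.span (stRing K) {g₁, g₂}) ⟨varS, hs⟩ (ih hp))
      (Submodule.smul_mem (Submodule.span (stRing K) {g₁, g₂}) ⟨varT, ht⟩ (ih hq))

lemma span_products (hdim : ∀ i, Module.finrank K (piece S i 1) = 2 * (i + 1) - 2 * k)
    (hg : Submodule.span K {g₁, g₂} = piece S k 1) :
    Submodule.span K (Set.range (products g₁ g₂)) = piece S (k + 1) 1 := by
  apply le_antisymm
  · obtain ⟨hg₁, hg₂⟩ := mem_piece_of_span_eq hg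
    refine Submodule.span_le.mpr (Set.range_subset_iff.mpr fun i => ?_)
    fin_cases i
    exacts [X_inl_mul_mem_piece 0 hg₁, X_inl_mul_mem_piece 1 hg₁, X_inl_mul_mem_piece 0 hg₂,
      X_inl_mul_mem_piece 1 hg₂]
  · intro f hf
    obtain ⟨p, hp, q, hq, rfl⟩ := exists_of_mem_piece_succ hdim le_rfl hf
    rw [← hg, Submodule.mem_span_pair] at hp hq
    obtain ⟨a, b, rfl⟩ := hp
    obtain ⟨c, d, rfl⟩ := hq
    refine (Submodule.mem_span_range_iff_exists_fun K).mpr ⟨![a, c, b, d], ?_⟩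
    simp only [Fin.sum_univ_four, products, varS, varT, smul_eq_C_mul, Matrix.cons_val]
    ring

lemma linearIndependent_products
    (hdim : ∀ i, Module.finrank K (piece S i 1) = 2 * (i + 1) - 2 * k)
    (hg : Submodule.span K {g₁, g₂} = piece S k 1) : LinearIndependent K (products g₁ g₂) := by
  rw [linearIndependent_iff_card_eq_finrank_span, Set.finrank, span_products hdim hg, hdim,
    Fintype.card_fin]
  omega

end HilbertFunction

section Image

lemma mk_mem_imageSet {f : Fin 4 → Cox K} {a b : ℕ} (hf : ∀ i, f i ∈ forms K a b)
    {x y : Fin 2 → K} (hx : x ≠ 0) (hy : y ≠ 0) {v : Fin 4 → K} (hv : v ≠ 0) {c : K}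
    (h : ∀ i, eval (Sum.elim x y) (f i) = c * v i) (hc : c ≠ 0) :
    Projectivization.mk K v hv ∈ imageSet f := by
  obtain ⟨l, hl⟩ := Projectivization.exists_smul_eq_mk_rep K x hx
  obtain ⟨m, hm⟩ := Projectivization.exists_smul_eq_mk_rep K y hy
  let P : Pt K := (Projectivization.mk K x hx, Projectivization.mk K y hy)
  have evalAt_eq : evalAt f P = ((l : K) ^ a * (m : K) ^ b * c) • v := by
    funext i
    rw [evalAt, ← hl, ← hm, Units.smul_def, Units.smul_def, eval_smul_forms (hf i), h,
      Pi.smul_apply, smul_eq_mul, mul_assoc _ c]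
  have coeff_ne_zero : (l : K) ^ a * (m : K) ^ b * c ≠ 0 := by simp [hc]
  have evalAt_ne_zero : evalAt f P ≠ 0 := evalAt_eq ▸ smul_ne_zero coeff_ne_zero hv
  exact ⟨P, evalAt_ne_zero, ((Projectivization.mk_eq_mk_iff' K _ _ evalAt_ne_zero hv).mpr
    ⟨_, evalAt_eq.symm⟩).symm⟩

lemma imageSet_products_subset_quadric (g₁ g₂ : Cox K) :
    imageSet (products g₁ g₂) ⊆ quadric K := by
  rintro _ ⟨P, hP, rfl⟩
  have evalAt_eq : evalAt (products g₁ g₂) P = segre _ _ := funext (eval_products g₁ g₂ _ _)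
  simp only [evalAt_eq] at hP ⊢
  exact mk_segre_mem_quadric hP

lemma products_mem_forms {g₁ g₂ : Cox K} {a b : ℕ} (hg₁ : g₁ ∈ forms K a b)
    (hg₂ : g₂ ∈ forms K a b) (i : Fin 4) : products g₁ g₂ i ∈ forms K (1 + a) (0 + b) := by
  fin_cases i
  exacts [mul_mem_forms (X_inl_mem_forms 0) hg₁, mul_mem_forms (X_inl_mem_forms 1) hg₁,
    mul_mem_forms (X_inl_mem_forms 0) hg₂, mul_mem_forms (X_inl_mem_forms 1) hg₂]

variable {a : ℕ} {a₁ b₁ a₂ b₂ : Cox K}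

lemma mk_segre_mem_imageSet_products (ha₁ : a₁ ∈ forms K a 0) (hb₁ : b₁ ∈ forms K a 0)
    (ha₂ : a₂ ∈ forms K a 0) (hb₂ : b₂ ∈ forms K a 0) {x y : Fin 2 → K} (hx : x ≠ 0) (hy : y ≠ 0)
    (hdet : eval (Sum.elim x y) (a₁ * b₂ - a₂ * b₁) ≠ 0) :
    Projectivization.mk K (segre x y) (segre_ne_zero hx hy) ∈
      imageSet (products (a₁ * X (Sum.inr 0) + b₁ * X (Sum.inr 1))
        (a₂ * X (Sum.inr 0) + b₂ * X (Sum.inr 1))) := by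
  let ev (f : Cox K) : K := eval (Sum.elim x y) f
  -- Cramer's rule: `(g₁, g₂)` takes the value `det • y` at `(x, z)`.
  let z : Fin 2 → K := ![ev b₂ * y 0 - ev b₁ * y 1, ev a₁ * y 1 - ev a₂ * y 0]
  have eval_gens : ![eval (Sum.elim x z) (a₁ * X (Sum.inr 0) + b₁ * X (Sum.inr 1)),
      eval (Sum.elim x z) (a₂ * X (Sum.inr 0) + b₂ * X (Sum.inr 1))] =
        ev (a₁ * b₂ - a₂ * b₁) • y := by
    simp only [map_add, map_mul, eval_X, Sum.elim_inr, eval_forms_zero ha₁ x z y,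
      eval_forms_zero hb₁ x z y, eval_forms_zero ha₂ x z y, eval_forms_zero hb₂ x z y]
    funext i
    fin_cases i <;>
    · simp only [z, ev, map_sub, map_mul, Pi.smul_apply, smul_eq_mul, Fin.zero_eta, Fin.mk_one,
        Matrix.cons_val]
      ring
  have hz : z ≠ 0 := by
    intro hz
    have det_smul_eq_zero : ev (a₁ * b₂ - a₂ * b₁) • y = 0 := by
      rw [← eval_gens, hz]
      simp
    exact smul_ne_zero hdet hy det_smul_eq_zero
  have mul_X_mem {p : Cox K} (hp : p ∈ forms K a 0) (j : Fin 2) :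
      p * X (Sum.inr j) ∈ forms K (a + 0) (0 + 1) :=
    mul_mem_forms hp (isWeightedHomogeneous_X K bideg (Sum.inr j))
  refine mk_mem_imageSet (products_mem_forms (add_mem (mul_X_mem ha₁ 0) (mul_X_mem hb₁ 1))
    (add_mem (mul_X_mem ha₂ 0) (mul_X_mem hb₂ 1))) hx hz _ (fun i => ?_) hdet
  rw [eval_products, eval_gens, segre_smul_right, Pi.smul_apply, smul_eq_mul]

lemma surface_products_eq_quadric_of_det_ne_zero [Infinite K] (ha₁ : a₁ ∈ forms K a 0)
    (hb₁ : b₁ ∈ forms K a 0) (ha₂ : a₂ ∈ forms K a 0) (hb₂ : b₂ ∈ forms K a 0)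
    (hdet : a₁ * b₂ - a₂ * b₁ ≠ 0) :
    surface (products (a₁ * X (Sum.inr 0) + b₁ * X (Sum.inr 1))
      (a₂ * X (Sum.inr 0) + b₂ * X (Sum.inr 1))) = quadric K := by
  rw [surface, vanishing_eq_span_quadricPoly (imageSet_products_subset_quadric _ _) hdet
    fun x y => mk_segre_mem_imageSet_products ha₁ hb₁ ha₂ hb₂, zeros_span]
  rfl

lemma surface_products_eq_quadric [Infinite K] {S : Finset (Pt K)} {k : ℕ}
    (hdim : ∀ i, Module.finrank K (piece S i 1) = 2 * (i + 1) - 2 * k) {g₁ g₂ : Cox K}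
    (hg : Submodule.span K {g₁, g₂} = piece S k 1) :
    surface (products g₁ g₂) = quadric K := by
  obtain ⟨hg₁, hg₂⟩ := mem_piece_of_span_eq hg
  obtain ⟨a₁, ha₁, b₁, hb₁, rfl⟩ := exists_eq_of_mem_forms_one hg₁.2
  obtain ⟨a₂, ha₂, b₂, hb₂, rfl⟩ := exists_eq_of_mem_forms_one hg₂.2
  refine surface_products_eq_quadric_of_det_ne_zero ha₁ hb₁ ha₂ hb₂ fun hdet => ?_
  obtain ⟨rfl, neg_a₁⟩ := eq_zero_of_syzygy hdim hg ha₂ (neg_mem ha₁)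
    (by linear_combination -X (Sum.inr 1) * hdet)
  obtain ⟨rfl, neg_b₁⟩ := eq_zero_of_syzygy hdim hg hb₂ (neg_mem hb₁)
    (by linear_combination X (Sum.inr 0) * hdet)
  have one_eq_zero : (1 : Cox K) = 0 := (eq_zero_of_syzygy hdim hg
    (isWeightedHomogeneous_one K bideg) (zero_mem (forms K 0 0)) (by
      rw [neg_eq_zero.mp neg_a₁, neg_eq_zero.mp neg_b₁]
      ring)).1
  exact one_ne_zero one_eq_zero

end Image

end TensorSurface

theorem mainTheorem5_general {K : Type*} [Field K] [Infinite K] (k : ℕ)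
    (X : Finset (TensorSurface.Pt K))
    (hX : ∀ i : ℕ, TensorSurface.hilbertFunction X i 1 = min (2 * ((i : ℤ) + 1)) (2 * k)) :
    Module.finrank K (TensorSurface.piece X k 1) = 2 ∧
    ∀ g₁ g₂ : TensorSurface.Cox K,
      Submodule.span K {g₁, g₂} = TensorSurface.piece X k 1 →
      ((Submodule.span (TensorSurface.stRing K) {g₁, g₂}).restrictScalars K
          = ⨆ i : ℕ, TensorSurface.piece X i 1) ∧
      LinearIndependent K (TensorSurface.products g₁ g₂) ∧
      Submodule.span K (Set.range (TensorSurface.products g₁ g₂))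
          = TensorSurface.piece X (k + 1) 1 ∧
      TensorSurface.surface (TensorSurface.products g₁ g₂) = TensorSurface.quadric K ∧
      TensorSurface.IsSmoothClosed (TensorSurface.quadric K) ∧
      ∀ U : Submodule K (TensorSurface.Cox K),
        U ≤ TensorSurface.piece X (k + 1) 1 → Module.finrank K U = 4 →
        U = TensorSurface.piece X (k + 1) 1 ∧
        ∀ f : Fin 4 → TensorSurface.Cox K,
          LinearIndependent K f → Submodule.span K (Set.range f) = U →
          TensorSurface.IsSmoothClosed (TensorSurface.surface f) ∧
          ∃ e : (Fin 4 → K) ≃ₗ[K] (Fin 4 → K),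
            (∀ i, f i = ∑ j, LinearMap.toMatrix' e.toLinearMap i j
                • TensorSurface.products g₁ g₂ j) ∧
            TensorSurface.surface f
              = Projectivization.map e.toLinearMap e.injective '' TensorSurface.quadric K := by
  have hdim (i : ℕ) := TensorSurface.finrank_piece_one_of_hilbertFunction (hX i)
  refine ⟨by rw [hdim]; omega, fun g₁ g₂ hg => ?_⟩
  have hspan := TensorSurface.span_products hdim hg
  have hsurface := TensorSurface.surface_products_eq_quadric hdim hg
  refine ⟨TensorSurface.span_stRing_eq hdim hg, TensorSurface.linearIndependent_products hdim hg,
    hspan, hsurface, TensorSurface.isSmoothClosed_quadric, fun U hU finrank_U => ?_⟩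
  obtain rfl : U = TensorSurface.piece X (k + 1) 1 :=
    Submodule.eq_of_le_of_finrank_eq hU (by rw [finrank_U, hdim]; omega)
  refine ⟨rfl, fun f hf span_f => ?_⟩
  obtain ⟨e, he⟩ := TensorSurface.exists_linearEquiv_of_span_eq hf (span_f.trans hspan.symm).le
  have surface_f := TensorSurface.surface_linear_change he
  rw [hsurface] at surface_f
  exact ⟨surface_f ▸ TensorSurface.isSmoothClosed_projMap_image_quadric e, e, he, surface_f⟩

theorem mainTheorem5 {K : Type*} [Field K] [IsAlgClosed K] [CharZero K] (k : ℕ)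
    (X : Finset (TensorSurface.Pt K)) (hcard : X.card = 2 * k)
    (hX : TensorSurface.IsGeneric X) :
    Module.finrank K (TensorSurface.piece X k 1) = 2 ∧
    ∀ g₁ g₂ : TensorSurface.Cox K,
      LinearIndependent K ![g₁, g₂] →
      Submodule.span K {g₁, g₂} = TensorSurface.piece X k 1 →
      ((Submodule.span (TensorSurface.stRing K) {g₁, g₂}).restrictScalars K
          = ⨆ i : ℕ, TensorSurface.piece X i 1) ∧
      LinearIndependent K (TensorSurface.products g₁ g₂) ∧
      Submodule.span K (Set.range (TensorSurface.products g₁ g₂))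
          = TensorSurface.piece X (k + 1) 1 ∧
      TensorSurface.surface (TensorSurface.products g₁ g₂) = TensorSurface.quadric K ∧
      TensorSurface.IsSmoothClosed (TensorSurface.quadric K) ∧
      ∀ U : Submodule K (TensorSurface.Cox K),
        U ≤ TensorSurface.piece X (k + 1) 1 → Module.finrank K U = 4 →
        U = TensorSurface.piece X (k + 1) 1 ∧
        ∀ f : Fin 4 → TensorSurface.Cox K,
          LinearIndependent K f → Submodule.span K (Set.range f) = U →
          TensorSurface.IsSmoothClosed (TensorSurface.surface f) ∧
          ∃ e : (Fin 4 → K) ≃ₗ[K] (Fin 4 → K),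
            (∀ i, f i = ∑ j, LinearMap.toMatrix' e.toLinearMap i j
                • TensorSurface.products g₁ g₂ j) ∧
            TensorSurface.surface f
              = Projectivization.map e.toLinearMap e.injective '' TensorSurface.quadric K := by
  exact (mainTheorem5_general k X fun i => by
    simpa [hcard, one_add_one_eq_two, mul_comm] using hX i 1).imp_right fun h g₁ g₂ _ => h g₁ g₂
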